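/- Every irrational $x\in(0,1)$ has a unique infinite regular continued fraction expansion $$x=\cfrac{1}{a_1(x)+\cfrac{1}{a_2(x)+\cfrac{1}{a_3(x)+\ddots}}}$$ with positive integers $a_k(x)$ (the partial quotients of $x$). For $n\ge 1$ put $T_n(x)=\max\{a_k(x):1\le k\le n\}$. Let $b,c>1$ and $\beta>0$ be real numbers. For real $\alpha>0$ let $$E(b,c,\alpha,\beta)=\Big\{x\in(0,1)\ \text{irrational}:\ \lim_{n\to\infty}\frac{T_n(x)}{c^{\,b^{\,n^{\alpha}}}}=\beta\Big\}.$$ Then the Hausdorff dimension of this set is $$\dim_{\mathrm H}E(b,c,\alpha,\beta)=\begin{cases}1/2, & 0<\alpha<1,\\ 1/(b+1), & \alpha=1,\\ 0, & \alpha>1.\end{cases}$$ -/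

import Mathlib

open Set Filter Topology
open scoped ENNReal

/-- The `k`-th partial quotient `a_k(x)` (`k ≥ 1`) of the regular continued fraction expansion
`x = [a_1(x), a_2(x), …]` of an irrational `x ∈ (0,1)`. Mathlib's list of partial denominators is
indexed from `0` and its entries are integers viewed as real numbers, so that `⌊·⌋₊` only turns the
entry into a natural number. -/
noncomputable def partialQuotient (x : ℝ) (k : ℕ) : ℕ :=
  ⌊((GenContFract.of x).partDens.get? (k - 1)).getD 0⌋₊

/-- `T_n(x) = max {a_k(x) : 1 ≤ k ≤ n}`, the largest of the first `n` partial quotients. -/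
noncomputable def maxPartialQuotient (x : ℝ) (n : ℕ) : ℕ :=
  (Finset.Icc 1 n).sup (partialQuotient x)

/-- The set of irrational `x ∈ (0,1)` with `T_n(x) / c ^ (b ^ (n ^ α)) → β` as `n → ∞`. -/
def doublyExpSet (b c α β : ℝ) : Set ℝ :=
  {x | x ∈ Ioo (0 : ℝ) 1 ∧ Irrational x ∧
    Tendsto (fun n : ℕ => (maxPartialQuotient x n : ℝ) / c ^ (b ^ ((n : ℝ) ^ α))) atTop (𝓝 β)}

/-! Write the scale at `n + 1` as `exp (l n)`, with `l n = log c * b ^ ((n + 1) ^ α)`, and let S_n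
be the sum of `l k` over `k < n`. For every α > 0 the ratio of consecutive scales tends to infinity,
so the running maximum is eventually attained by the newest digit: the limit condition on T_n is
equivalent to the same condition on the digits themselves (`tendsto_sup_div_iff`).

The dimension is then the limit of S_n / (2 S_n + l_n). From above (`dimH_maxDigitSet_le`), about
exp(S_n) words of length n occur. A cylinder has diameter about exp(-(2 S_n + l_n)): the n fixed
digits contract by their squares, and the next digit, being of size exp(l_n), confines the orbit to
an interval of length exp(-l_n). From below (`le_dimH_maxDigitSet`), digits chosen freely in windows
of length exp(l_k)/(k+1) above β exp(l_k) are coded by mixed radix expansions of t in [0,1). The map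
from t to x has an s-Hölder inverse for every s below that limit. All factors exponential or
factorial in n are absorbed in an error C(n+1)^2, negligible against l_n.

Finally, l_n = o(S_n) for α < 1, S_n ~ l_n/(b-1) for α = 1, and S_n = o(l_n) for α > 1. This gives
1/2, 1/(b+1) and 0. -/

/-! ### Gauss map and partial quotients -/

/-- The orbit of `x` under the Gauss map `t ↦ fract (1 / t)`. -/
noncomputable def gaussOrbit (x : ℝ) : ℕ → ℝ
  | 0 => x
  | n + 1 => Int.fract (gaussOrbit x n)⁻¹

/-- The partial quotients of `x`, indexed from `0`. -/
noncomputable def cfDigit (x : ℝ) (n : ℕ) : ℕ := ⌊(gaussOrbit x n)⁻¹⌋₊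

/-- The irrational numbers of the unit interval. -/
def unitIrrational : Set ℝ := {x | x ∈ Ioo (0 : ℝ) 1 ∧ Irrational x}

theorem gaussOrbit_mem {x : ℝ} (hx : x ∈ unitIrrational) (n : ℕ) :
    gaussOrbit x n ∈ unitIrrational := by
  induction n with
  | zero => exact hx
  | succ n ih =>
    have hirr : Irrational (Int.fract (gaussOrbit x n)⁻¹) := by
      exact (irrational_inv_iff.2 ih.2).sub_intCast ⌊(gaussOrbit x n)⁻¹⌋
    refine ⟨⟨lt_of_le_of_ne (Int.fract_nonneg _) ?_, Int.fract_lt_one _⟩, hirr⟩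
    exact hirr.ne_zero.symm

theorem inv_gaussOrbit {x : ℝ} (hx : x ∈ unitIrrational) (n : ℕ) :
    (gaussOrbit x n)⁻¹ = cfDigit x n + gaussOrbit x (n + 1) := by
  have h0 : 0 ≤ (gaussOrbit x n)⁻¹ := inv_nonneg.2 (gaussOrbit_mem hx n).1.1.le
  rw [cfDigit, gaussOrbit, natCast_floor_eq_intCast_floor h0, Int.floor_add_fract]

theorem one_le_cfDigit {x : ℝ} (hx : x ∈ unitIrrational) (n : ℕ) : 1 ≤ cfDigit x n := by
  have h := (gaussOrbit_mem hx n).1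
  exact Nat.le_floor (by simpa using (one_le_inv₀ h.1).2 h.2.le)

theorem stream_eq_gaussOrbit {x : ℝ} (hx : x ∈ Ioo (0 : ℝ) 1) (h : ∀ n, gaussOrbit x n ≠ 0)
    (n : ℕ) : ∃ z : ℤ, GenContFract.IntFractPair.stream x n = some ⟨z, gaussOrbit x n⟩ := by
  induction n with
  | zero =>
    refine ⟨⌊x⌋, ?_⟩
    rw [GenContFract.IntFractPair.stream_zero, GenContFract.IntFractPair.of, gaussOrbit,
      Int.fract_eq_self.2 ⟨hx.1.le, hx.2⟩]
  | succ n ih =>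
    obtain ⟨z, hz⟩ := ih
    exact ⟨_, GenContFract.IntFractPair.stream_succ_of_some hz (h n)⟩

theorem partialQuotient_succ {x : ℝ} (hx : x ∈ unitIrrational) (n : ℕ) :
    partialQuotient x (n + 1) = cfDigit x n := by
  have hne : ∀ n, gaussOrbit x n ≠ 0 := fun n => (gaussOrbit_mem hx n).2.ne_zero
  obtain ⟨z, hz⟩ := stream_eq_gaussOrbit hx.1 hne n
  have h := GenContFract.get?_of_eq_some_of_get?_intFractPair_stream_fr_ne_zero hz (hne n)
  have h0 : 0 ≤ (gaussOrbit x n)⁻¹ := inv_nonneg.2 (gaussOrbit_mem hx n).1.1.le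
  have h' : (GenContFract.of x).partDens.get? n = some (⌊(gaussOrbit x n)⁻¹⌋ : ℝ) := by
    rw [GenContFract.partDens, Stream'.Seq.map_get?, h]
    rfl
  rw [partialQuotient, Nat.add_sub_cancel, h', Option.getD_some,
    ← natCast_floor_eq_intCast_floor h0, Nat.floor_natCast, cfDigit]

theorem maxPartialQuotient_succ {x : ℝ} (hx : x ∈ unitIrrational) (n : ℕ) :
    maxPartialQuotient x (n + 1) = (Finset.range (n + 1)).sup (cfDigit x) := by
  have : Finset.Icc 1 (n + 1) = (Finset.range (n + 1)).image Nat.succ := by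
    ext k
    simp only [Finset.mem_Icc, Finset.mem_image, Finset.mem_range]
    constructor
    · rintro ⟨h1, h2⟩
      exact ⟨k - 1, by omega, by omega⟩
    · rintro ⟨j, h1, rfl⟩
      omega
  rw [maxPartialQuotient, this, Finset.sup_image]
  exact Finset.sup_congr rfl fun k _ => partialQuotient_succ hx k

/-- The expansion of a rational terminates, whereas nonzero remainders keep the stream going
forever. -/
theorem irrational_of_gaussOrbit_ne_zero {x : ℝ} (hx : x ∈ Ioo (0 : ℝ) 1)
    (h : ∀ n, gaussOrbit x n ≠ 0) : Irrational x := by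
  rintro ⟨q, rfl⟩
  obtain ⟨n, hn⟩ := (GenContFract.terminates_iff_rat (q : ℝ)).2 ⟨q, rfl⟩
  have hn := GenContFract.of_terminatedAt_n_iff_succ_nth_intFractPair_stream_eq_none.1 hn
  obtain ⟨z, hz⟩ := stream_eq_gaussOrbit hx h (n + 1)
  simp [hn] at hz

/-! ### Distances and separation in cylinders -/

theorem abs_sub_mul_inv_mul_inv {s t : ℝ} (hs : 0 < s) (ht : 0 < t) :
    |s - t| * (s⁻¹ * t⁻¹) = |s⁻¹ - t⁻¹| := by
  rw [← abs_of_pos (mul_pos (inv_pos.2 hs) (inv_pos.2 ht)), ← abs_mul, abs_sub_comm s⁻¹]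
  congr 1
  field_simp

/-- Distances in a cylinder contract at least by the product of the squared partial quotients. -/
theorem abs_sub_mul_prod_sq_le {x y : ℝ} (hx : x ∈ unitIrrational) (hy : y ∈ unitIrrational)
    (n : ℕ) (h : ∀ k < n, cfDigit x k = cfDigit y k) :
    |x - y| * ∏ k ∈ Finset.range n, (cfDigit x k : ℝ) ^ 2 ≤
      |gaussOrbit x n - gaussOrbit y n| := by
  induction n with
  | zero => simp [gaussOrbit]
  | succ n ih =>
    have ih := ih fun k hk => h k (by omega)
    rw [Finset.prod_range_succ, ← mul_assoc]
    have hx1 := inv_gaussOrbit hx n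
    have hy1 := inv_gaussOrbit hy n
    rw [← h n (by omega)] at hy1
    have hx2 := (gaussOrbit_mem hx (n + 1)).1.1
    have hy2 := (gaussOrbit_mem hy (n + 1)).1.1
    have hd : (0 : ℝ) ≤ cfDigit x n := Nat.cast_nonneg _
    have hle : (cfDigit x n : ℝ) ^ 2 ≤ (gaussOrbit x n)⁻¹ * (gaussOrbit y n)⁻¹ := by
      rw [hx1, hy1, sq]
      gcongr <;> linarith
    calc _ ≤ |gaussOrbit x n - gaussOrbit y n| *
          ((gaussOrbit x n)⁻¹ * (gaussOrbit y n)⁻¹) := by gcongr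
      _ = |gaussOrbit x (n + 1) - gaussOrbit y (n + 1)| := by
        rw [abs_sub_mul_inv_mul_inv (gaussOrbit_mem hx n).1.1 (gaussOrbit_mem hy n).1.1, hx1, hy1,
          add_sub_add_left_eq_sub]

/-- Distances in a cylinder contract at most by the product of squared upper bounds of the complete
quotients. -/
theorem abs_gaussOrbit_sub_le {x y : ℝ} (hx : x ∈ unitIrrational)
    (hy : y ∈ unitIrrational) {B : ℕ → ℝ} (hxB : ∀ k, (cfDigit x k : ℝ) + 1 ≤ B k)
    (hyB : ∀ k, (cfDigit y k : ℝ) + 1 ≤ B k) (n : ℕ) (h : ∀ k < n, cfDigit x k = cfDigit y k) :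
    |(cfDigit x n + gaussOrbit x (n + 1)) - (cfDigit y n + gaussOrbit y (n + 1))| ≤
      |x - y| * ∏ k ∈ Finset.range (n + 1), B k ^ 2 := by
  have hle : ∀ n, (gaussOrbit x n)⁻¹ * (gaussOrbit y n)⁻¹ ≤ B n ^ 2 := by
    intro n
    have hx2 := (gaussOrbit_mem hx (n + 1)).1
    have hy2 := (gaussOrbit_mem hy (n + 1)).1
    have hd : (0 : ℝ) ≤ cfDigit x n := Nat.cast_nonneg _
    have hd' : (0 : ℝ) ≤ cfDigit y n := Nat.cast_nonneg _
    rw [inv_gaussOrbit hx n, inv_gaussOrbit hy n, sq]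
    exact mul_le_mul (by linarith [hxB n, hx2.2]) (by linarith [hyB n, hy2.2])
      (by linarith [hy2.1]) (by linarith [hxB n])
  induction n with
  | zero =>
    have h0 := hle 0
    rw [← inv_gaussOrbit hx, ← inv_gaussOrbit hy, Finset.prod_range_one,
      ← abs_sub_mul_inv_mul_inv (gaussOrbit_mem hx 0).1.1 (gaussOrbit_mem hy 0).1.1]
    exact mul_le_mul_of_nonneg_left h0 (abs_nonneg _)
  | succ n ih =>
    have ih := ih fun k hk => h k (by omega)
    rw [h n (by omega), add_sub_add_left_eq_sub] at ih
    rw [← inv_gaussOrbit hx, ← inv_gaussOrbit hy, Finset.prod_range_succ, ← mul_assoc,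
      ← abs_sub_mul_inv_mul_inv (gaussOrbit_mem hx _).1.1 (gaussOrbit_mem hy _).1.1]
    exact mul_le_mul ih (hle _) (mul_pos (inv_pos.2 (gaussOrbit_mem hx _).1.1)
      (inv_pos.2 (gaussOrbit_mem hy _).1.1)).le ((abs_nonneg _).trans ih)

theorem gaussOrbit_le_half {x : ℝ} (hx : x ∈ unitIrrational) {n : ℕ} (h : 2 ≤ cfDigit x n) :
    gaussOrbit x n ≤ 1 / 2 := by
  have h1 := inv_gaussOrbit hx n
  have h2 := (gaussOrbit_mem hx (n + 1)).1.1
  have h3 : (2 : ℝ) ≤ cfDigit x n := by exact_mod_cast h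
  rw [one_div]
  exact (le_inv_comm₀ (gaussOrbit_mem hx n).1.1 two_pos).2 (by linarith)

/-- Points which separate at the `n`-th partial quotient are far apart. -/
theorem abs_cfDigit_sub_le {x y : ℝ} (hx : x ∈ unitIrrational)
    (hy : y ∈ unitIrrational) {B : ℕ → ℝ} (hxB : ∀ k, (cfDigit x k : ℝ) + 1 ≤ B k)
    (hyB : ∀ k, (cfDigit y k : ℝ) + 1 ≤ B k) (hx2 : ∀ k, 2 ≤ cfDigit x k)
    (hy2 : ∀ k, 2 ≤ cfDigit y k) (n : ℕ) (h : ∀ k < n, cfDigit x k = cfDigit y k)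
    (hn : cfDigit x n ≠ cfDigit y n) :
    |(cfDigit x n : ℝ) - cfDigit y n| ≤ 2 * (|x - y| * ∏ k ∈ Finset.range (n + 1), B k ^ 2) := by
  have h1 := abs_gaussOrbit_sub_le hx hy hxB hyB n h
  have hx3 := gaussOrbit_le_half hx (hx2 (n + 1))
  have hy3 := gaussOrbit_le_half hy (hy2 (n + 1))
  have hx4 := (gaussOrbit_mem hx (n + 1)).1.1
  have hy4 := (gaussOrbit_mem hy (n + 1)).1.1
  have h2 : (1 : ℝ) ≤ |(cfDigit x n : ℝ) - cfDigit y n| := by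
    have : (1 : ℤ) ≤ |(cfDigit x n : ℤ) - cfDigit y n| :=
      Int.one_le_abs (sub_ne_zero.2 (by exact_mod_cast hn))
    exact_mod_cast this
  -- Digits at least 2 keep both tails in (0, 1/2], so they can cancel at most half of the digit
  -- gap, which is at least 1.
  have h3 : |gaussOrbit x (n + 1) - gaussOrbit y (n + 1)| ≤ 1 / 2 := by
    rw [abs_le]; constructor <;> linarith
  have h4 := abs_sub_abs_le_abs_sub ((cfDigit x n : ℝ) - cfDigit y n)
    (gaussOrbit y (n + 1) - gaussOrbit x (n + 1))
  rw [abs_sub_comm (gaussOrbit y (n + 1))] at h4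
  have h5 : (cfDigit x n : ℝ) - cfDigit y n - (gaussOrbit y (n + 1) - gaussOrbit x (n + 1)) =
    (cfDigit x n + gaussOrbit x (n + 1)) - (cfDigit y n + gaussOrbit y (n + 1)) := by ring
  rw [h5] at h4
  linarith

/-! ### Irrationals with prescribed digits -/

/-- The finite continued fractions `[a k, …, a (k + n - 1)]`. -/
noncomputable def finiteCF (a : ℕ → ℕ) : ℕ → ℕ → ℝ
  | 0, _ => 0
  | n + 1, k => (a k + finiteCF a n (k + 1))⁻¹

theorem finiteCF_mem {a : ℕ → ℕ} (ha : ∀ k, 2 ≤ a k) (n k : ℕ) :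
    finiteCF a n k ∈ Icc (0 : ℝ) (1 / 2) := by
  induction n generalizing k with
  | zero => norm_num [finiteCF]
  | succ n ih =>
    have h2 : (2 : ℝ) ≤ a k := by exact_mod_cast ha k
    have h := (ih (k + 1)).1
    rw [finiteCF, one_div]
    exact ⟨inv_nonneg.2 (by linarith), inv_anti₀ two_pos (by linarith)⟩

/-- For a ≥ 2 the map t ↦ 1/(a + t) contracts [0, ∞) by the factor 1/4, and one such map is applied
per level. -/
theorem abs_finiteCF_succ_sub_le {a : ℕ → ℕ} (ha : ∀ k, 2 ≤ a k) (n k : ℕ) :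
    |finiteCF a (n + 1) k - finiteCF a n k| ≤ (1 / 4 : ℝ) ^ n := by
  induction n generalizing k with
  | zero =>
    have h := finiteCF_mem ha 1 k
    have h' := finiteCF_mem ha 0 k
    rw [pow_zero, abs_le]
    constructor <;> linarith [h.1, h.2, h'.1, h'.2]
  | succ n ih =>
    have h2 : (2 : ℝ) ≤ a k := by exact_mod_cast ha k
    have h := (finiteCF_mem ha (n + 1) (k + 1)).1
    have h' := (finiteCF_mem ha n (k + 1)).1
    have ih := ih (k + 1)
    change |((a k : ℝ) + finiteCF a (n + 1) (k + 1))⁻¹ - ((a k : ℝ) + finiteCF a n (k + 1))⁻¹| ≤ _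
    rw [← abs_sub_mul_inv_mul_inv (by linarith) (by linarith),
      add_sub_add_left_eq_sub, pow_succ]
    refine mul_le_mul ih ?_ (by positivity) (by positivity)
    rw [← mul_inv, one_div]
    exact inv_anti₀ (by norm_num) (by nlinarith)

/-- Every sequence of digits at least two is the sequence of partial quotients of an irrational. -/
theorem exists_cfDigit_eq {a : ℕ → ℕ} (ha : ∀ k, 2 ≤ a k) :
    ∃ x ∈ unitIrrational, ∀ k, cfDigit x k = a k := by
  have hlim : ∀ k, ∃ l, Tendsto (fun n => finiteCF a n k) atTop (𝓝 l) := fun k =>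
    cauchySeq_tendsto_of_complete <| cauchySeq_of_le_geometric (1 / 4) 1 (by norm_num) fun n => by
      rw [dist_comm, Real.dist_eq, one_mul]
      exact abs_finiteCF_succ_sub_le ha n k
  choose X hX using hlim
  have hmem : ∀ k, X k ∈ Icc (0 : ℝ) (1 / 2) := fun k =>
    isClosed_Icc.mem_of_tendsto (hX k) (Eventually.of_forall fun n => finiteCF_mem ha n k)
  have h2 : ∀ k, (2 : ℝ) ≤ a k := fun k => by exact_mod_cast ha k
  have hrec : ∀ k, X k = (a k + X (k + 1))⁻¹ := fun k =>
    tendsto_nhds_unique ((tendsto_add_atTop_iff_nat 1).2 (hX k))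
      ((tendsto_const_nhds.add (hX (k + 1))).inv₀
        (by have := (hmem (k + 1)).1; have := h2 k; linarith))
  have hpos : ∀ k, 0 < X k := fun k => by
    rw [hrec]
    have := (hmem (k + 1)).1
    have := h2 k
    exact inv_pos.2 (by linarith)
  have hfract : ∀ k, Int.fract (X (k + 1)) = X (k + 1) := fun k =>
    Int.fract_eq_self.2 ⟨(hmem _).1, by linarith [(hmem (k + 1)).2]⟩
  have horbit : ∀ n, gaussOrbit (X 0) n = X n := by
    intro n
    induction n with
    | zero => rfl
    | succ n ih => rw [gaussOrbit, ih, hrec, inv_inv, Int.fract_natCast_add, hfract]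
  have h01 : X 0 ∈ Ioo (0 : ℝ) 1 := ⟨hpos 0, by linarith [(hmem 0).2]⟩
  refine ⟨X 0, ⟨h01, irrational_of_gaussOrbit_ne_zero h01 fun n => ?_⟩, fun k => ?_⟩
  · rw [horbit]
    exact (hpos n).ne'
  · rw [cfDigit, horbit, hrec, inv_inv, add_comm, Nat.floor_add_natCast (hmem _).1,
      Nat.floor_eq_zero.2 (by linarith [(hmem (k + 1)).2]), zero_add]

/-! ### Running maxima and digits -/

theorem sup_range_succ_cast (a : ℕ → ℕ) (n : ℕ) :
    (((Finset.range (n + 1)).sup a : ℕ) : ℝ) = max (((Finset.range n).sup a : ℕ) : ℝ) (a n) := by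
  rw [Finset.range_add_one, Finset.sup_insert, sup_comm, ← Nat.cast_max]

/-- Along a scale whose consecutive ratios tend to infinity, running maxima and the sequence itself
have the same asymptotics. -/
theorem tendsto_sup_div_iff {φ : ℕ → ℝ} (hφ : ∀ n, 0 < φ n) (hmono : Monotone φ)
    (hratio : Tendsto (fun n => φ n / φ (n + 1)) atTop (𝓝 0)) (a : ℕ → ℕ) {β : ℝ} (hβ : 0 < β) :
    Tendsto (fun n => (((Finset.range (n + 1)).sup a : ℕ) : ℝ) / φ n) atTop (𝓝 β) ↔
      Tendsto (fun n => (a n : ℝ) / φ n) atTop (𝓝 β) := by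
  have hmax : ∀ n, (((Finset.range (n + 1 + 1)).sup a : ℕ) : ℝ) / φ (n + 1) =
      max ((((Finset.range (n + 1)).sup a : ℕ) : ℝ) / φ (n + 1)) ((a (n + 1) : ℝ) / φ (n + 1)) :=
    fun n => by rw [sup_range_succ_cast, max_div_div_right (hφ _).le]
  constructor
  · intro h
    rw [← tendsto_add_atTop_iff_nat 1]
    have h1 : Tendsto (fun n => (((Finset.range (n + 1)).sup a : ℕ) : ℝ) / φ (n + 1))
        atTop (𝓝 0) := by
      have := h.mul hratio
      rw [mul_zero] at this
      exact this.congr fun n => div_mul_div_cancel₀ (hφ n).ne'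
    have h2 := (tendsto_add_atTop_iff_nat 1).2 h
    refine h2.congr' ?_
    -- The old maximum falls below β/2 on the new scale while the new one exceeds β/2, so the new
    -- digit attains it.
    filter_upwards [h1.eventually_lt_const (half_pos hβ),
      h2.eventually_const_lt (half_lt_self hβ)] with n hn1 hn2
    rw [hmax] at hn2 ⊢
    exact max_eq_right ((lt_max_iff.1 hn2).resolve_left (by linarith) |>.le |> fun h => by linarith)
  · intro h
    obtain ⟨B, hB⟩ := h.bddAbove_range
    have hB' : ∀ k, (a k : ℝ) ≤ B * φ k := fun k =>
      (div_le_iff₀ (hφ k)).1 (hB (mem_range_self k))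
    have hB0 : 0 ≤ B := (div_nonneg (Nat.cast_nonneg (a 0)) (hφ 0).le).trans (hB (mem_range_self 0))
    have hsup : ∀ n, (((Finset.range (n + 1)).sup a : ℕ) : ℝ) ≤ B * φ n := fun n => by
      rw [← Nat.le_floor_iff (mul_nonneg hB0 (hφ n).le)]
      refine Finset.sup_le fun k hk => Nat.le_floor ((hB' k).trans ?_)
      exact mul_le_mul_of_nonneg_left (hmono (Nat.lt_succ_iff.1 (Finset.mem_range.1 hk))) hB0
    have h1 : Tendsto (fun n => (((Finset.range (n + 1)).sup a : ℕ) : ℝ) / φ (n + 1))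
        atTop (𝓝 0) := by
      refine squeeze_zero (fun n => div_nonneg (Nat.cast_nonneg _) (hφ _).le) (fun n => ?_)
        (by simpa using hratio.const_mul B)
      rw [← mul_div_assoc]
      exact div_le_div_of_nonneg_right (hsup n) (hφ _).le
    rw [← tendsto_add_atTop_iff_nat 1]
    have := h1.max ((tendsto_add_atTop_iff_nat 1).2 h)
    rw [max_eq_right hβ.le] at this
    exact this.congr fun n => (hmax n).symm

/-! ### Upper bound: covering by cylinders -/

theorem exp_sum_range (l : ℕ → ℝ) (n : ℕ) :
    ∏ k ∈ Finset.range n, Real.exp (l k) = Real.exp (∑ k ∈ Finset.range n, l k) :=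
  (Real.exp_sum _ _).symm

/-- The irrationals whose partial quotients are within a factor `D` of `exp (l k)`. -/
def comparableDigitSet (l : ℕ → ℝ) (D : ℕ) : Set ℝ :=
  {x | x ∈ unitIrrational ∧
    ∀ k, Real.exp (l k) ≤ D * cfDigit x k ∧ (cfDigit x k : ℝ) ≤ D * Real.exp (l k)}

/-- The cylinder of `comparableDigitSet l D` of order `n` given by a word `i`. -/
def comparableCylinder (l : ℕ → ℝ) (D n : ℕ)
    (i : (k : Fin n) → Fin (⌊(D : ℝ) * Real.exp (l k)⌋₊ + 1)) : Set ℝ :=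
  {x | x ∈ comparableDigitSet l D ∧ ∀ k : Fin n, cfDigit x k = i k}

/-- The n fixed digits contract distances by at least exp(2 S_n) / D^(2n), and the lower bound on
the next digit puts the n-th orbit points in (0, D exp(-l_n)]. -/
theorem ediam_comparableCylinder_le {l : ℕ → ℝ} {D : ℕ} (hD : 1 ≤ D) (n : ℕ)
    (i : (k : Fin n) → Fin (⌊(D : ℝ) * Real.exp (l k)⌋₊ + 1)) :
    Metric.ediam (comparableCylinder l D n i) ≤ ENNReal.ofReal
      ((D : ℝ) ^ (2 * n + 1) * Real.exp (-(2 * ∑ k ∈ Finset.range n, l k + l n))) := by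
  have hD0 : (0 : ℝ) < D := by exact_mod_cast hD
  have horb : ∀ x ∈ comparableDigitSet l D, gaussOrbit x n ≤ D * Real.exp (-l n) := by
    intro x hx
    have h1 := inv_gaussOrbit hx.1 n
    have h2 := (gaussOrbit_mem hx.1 (n + 1)).1.1
    have h3 := (gaussOrbit_mem hx.1 n).1.1
    have h4 := (hx.2 n).1
    have h5 : Real.exp (l n) ≤ D * (gaussOrbit x n)⁻¹ := by
      rw [h1]; nlinarith
    rw [← div_eq_mul_inv, le_div_iff₀ h3] at h5
    rw [Real.exp_neg, ← div_eq_mul_inv, le_div_iff₀ (Real.exp_pos _)]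
    linarith
  refine Metric.ediam_le fun x hx y hy => ?_
  rw [edist_dist, Real.dist_eq]
  refine ENNReal.ofReal_le_ofReal ?_
  have h1 := abs_sub_mul_prod_sq_le hx.1.1 hy.1.1 n fun k hk => by
    rw [hx.2 ⟨k, hk⟩, hy.2 ⟨k, hk⟩]
  have h2 : |gaussOrbit x n - gaussOrbit y n| ≤ D * Real.exp (-l n) := by
    have hx1 := (gaussOrbit_mem hx.1.1 n).1.1
    have hy1 := (gaussOrbit_mem hy.1.1 n).1.1
    rw [abs_le]
    constructor <;> linarith [horb x hx.1, horb y hy.1]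
  have h3 : Real.exp (2 * ∑ k ∈ Finset.range n, l k) / (D : ℝ) ^ (2 * n) ≤
      ∏ k ∈ Finset.range n, (cfDigit x k : ℝ) ^ 2 := by
    rw [Finset.prod_pow, div_le_iff₀ (by positivity), pow_mul', ← mul_pow, two_mul, Real.exp_add,
      ← sq, ← exp_sum_range]
    refine pow_le_pow_left₀ (Finset.prod_nonneg fun _ _ => (Real.exp_pos _).le) ?_ 2
    calc _ ≤ ∏ k ∈ Finset.range n, ((D : ℝ) * cfDigit x k) :=
          Finset.prod_le_prod (fun _ _ => (Real.exp_pos _).le) fun k _ => (hx.1.2 k).1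
      _ = _ := by rw [Finset.prod_mul_distrib, Finset.prod_const, Finset.card_range, mul_comm]
  have h4 := (mul_le_mul_of_nonneg_left h3 (abs_nonneg (x - y))).trans (h1.trans h2)
  rw [← mul_div_assoc, div_le_iff₀ (by positivity)] at h4
  rw [neg_add, Real.exp_add, Real.exp_neg, pow_succ, ← mul_assoc, mul_right_comm,
    ← div_eq_mul_inv, le_div_iff₀ (Real.exp_pos _)]
  calc _ ≤ _ := h4
    _ = _ := by ring

theorem dimH_comparableDigitSet_le {l : ℕ → ℝ} (h0 : ∀ k, 0 ≤ l k)
    (hpoly : ∀ C : ℝ, ∀ᶠ n : ℕ in atTop, C * ((n : ℝ) + 1) ^ 2 ≤ l n) {s : NNReal}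
    (hs : ∀ C : ℝ, ∀ᶠ n : ℕ in atTop, ∑ k ∈ Finset.range n, l k + C * ((n : ℝ) + 1) ^ 2 ≤
      s * (2 * ∑ k ∈ Finset.range n, l k + l n)) {D : ℕ} (hD : 1 ≤ D) :
    dimH (comparableDigitSet l D) ≤ s := by
  have hD0 : (0 : ℝ) < D := by exact_mod_cast hD
  have hD1 : (1 : ℝ) ≤ D := by exact_mod_cast hD
  have hlog : 0 ≤ Real.log D := Real.log_nonneg hD1
  have hr_eq : ∀ n : ℕ, (D : ℝ) ^ (2 * n + 1) * Real.exp (-(2 * ∑ k ∈ Finset.range n, l k + l n)) =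
      Real.exp ((2 * n + 1) * Real.log D - (2 * ∑ k ∈ Finset.range n, l k + l n)) := fun n => by
    rw [sub_eq_add_neg, Real.exp_add, mul_comm _ (Real.log D), Real.exp_mul, Real.exp_log hD0]
    norm_cast
  have hr : Tendsto (fun n : ℕ => ENNReal.ofReal
      ((D : ℝ) ^ (2 * n + 1) * Real.exp (-(2 * ∑ k ∈ Finset.range n, l k + l n)))) atTop
      (𝓝 0) := by
    rw [← ENNReal.ofReal_zero]
    refine ENNReal.tendsto_ofReal ?_
    simp_rw [hr_eq]
    refine Real.tendsto_exp_atBot.comp (tendsto_atBot_mono' _ ?_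
      (tendsto_neg_atTop_atBot.comp tendsto_natCast_atTop_atTop))
    filter_upwards [hpoly (2 * Real.log D + 1)] with n hn
    have h1 : 0 ≤ ∑ k ∈ Finset.range n, l k := Finset.sum_nonneg fun k _ => h0 k
    have h2 : (0 : ℝ) ≤ n := Nat.cast_nonneg n
    have h3 : (2 * (n : ℝ) + 1) * Real.log D ≤ 2 * Real.log D * (n + 1) ^ 2 := by
      nlinarith [mul_nonneg hlog h2, mul_nonneg hlog (sq_nonneg (n : ℝ))]
    simp only [Function.comp_apply]
    nlinarith
  have hle : MeasureTheory.Measure.hausdorffMeasure (s : ℝ) (comparableDigitSet l D) ≤ 1 := by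
    refine (MeasureTheory.Measure.hausdorffMeasure_le_liminf_sum (s : ℝ) _ _ hr
      (comparableCylinder l D)
      (Eventually.of_forall fun n i => ediam_comparableCylinder_le hD n i)
      (Eventually.of_forall fun n x hx => ?_)).trans ?_
    · refine mem_iUnion.2 ⟨fun k => ⟨cfDigit x k, Nat.lt_succ_of_le (Nat.le_floor (hx.2 k).2)⟩,
        hx, fun k => rfl⟩
    · refine liminf_le_of_frequently_le' (Eventually.frequently ?_)
      -- `log (2 * D)` pays for the number of words, at most (2D)^n exp(S_n); `2 * s * log D` pays
      -- for D^(2n+1) in the diameters raised to the power s.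
      filter_upwards [hs (Real.log (2 * D) + 2 * s * Real.log D)] with n hn
      have hcard : (((Finset.univ : Finset ((k : Fin n) →
          Fin (⌊(D : ℝ) * Real.exp (l k)⌋₊ + 1))).card : ℕ) : ℝ) ≤
          Real.exp (n * Real.log (2 * D) + ∑ k ∈ Finset.range n, l k) := by
        rw [Finset.card_univ, Fintype.card_pi, Real.exp_add, mul_comm (n : ℝ), Real.exp_mul,
          Real.exp_log (by positivity), ← exp_sum_range, Real.rpow_natCast]
        push_cast
        rw [← Fin.prod_univ_eq_prod_range (fun k => Real.exp (l k)) n]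
        calc _ ≤ ∏ k : Fin n, ((2 * D : ℝ) * Real.exp (l k)) := by
              refine Finset.prod_le_prod (fun _ _ => by positivity) fun k _ => ?_
              rw [Fintype.card_fin]
              push_cast
              have h1 := Nat.floor_le (a := (D : ℝ) * Real.exp (l k)) (by positivity)
              have h2 := Real.one_le_exp (h0 k)
              nlinarith
          _ = _ := by simp [Finset.prod_mul_distrib]
      calc _ ≤ ∑ i : ((k : Fin n) → Fin (⌊(D : ℝ) * Real.exp (l k)⌋₊ + 1)),
            (ENNReal.ofReal ((D : ℝ) ^ (2 * n + 1) *
              Real.exp (-(2 * ∑ k ∈ Finset.range n, l k + l n)))) ^ (s : ℝ) :=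
            Finset.sum_le_sum fun i _ =>
              ENNReal.rpow_le_rpow (ediam_comparableCylinder_le hD n i) s.2
        _ = ENNReal.ofReal ((((Finset.univ : Finset ((k : Fin n) →
          Fin (⌊(D : ℝ) * Real.exp (l k)⌋₊ + 1))).card : ℕ) : ℝ) * Real.exp (s *
              ((2 * n + 1) * Real.log D - (2 * ∑ k ∈ Finset.range n, l k + l n)))) := by
            rw [Finset.sum_const, nsmul_eq_mul, hr_eq, ENNReal.ofReal_rpow_of_pos (Real.exp_pos _),
              ← Real.exp_mul, ENNReal.ofReal_mul (Nat.cast_nonneg _), ENNReal.ofReal_natCast,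
              mul_comm (s : ℝ)]
        _ ≤ ENNReal.ofReal 1 := by
            refine ENNReal.ofReal_le_ofReal ?_
            refine (mul_le_mul_of_nonneg_right hcard (Real.exp_pos _).le).trans ?_
            rw [← Real.exp_add, Real.exp_le_one_iff]
            have h2 : (0 : ℝ) ≤ n := Nat.cast_nonneg n
            have h3 : 0 ≤ Real.log (2 * D) := Real.log_nonneg (by linarith)
            have h4 : (n : ℝ) * Real.log (2 * D) ≤ Real.log (2 * D) * (n + 1) ^ 2 := by
              nlinarith [mul_nonneg h3 h2, mul_nonneg h3 (sq_nonneg (n : ℝ))]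
            have h5 : (2 * (n : ℝ) + 1) * Real.log D ≤ 2 * Real.log D * (n + 1) ^ 2 := by
              nlinarith [mul_nonneg hlog h2, mul_nonneg hlog (sq_nonneg (n : ℝ))]
            have h6 := mul_le_mul_of_nonneg_left h5 s.2
            simp only [NNReal.val_eq_coe] at h6
            nlinarith
        _ = 1 := ENNReal.ofReal_one
  exact dimH_le_of_hausdorffMeasure_ne_top (hle.trans_lt ENNReal.one_lt_top).ne

/-! ### Mixed radix expansions -/

/-- The orbit of `t` under the fractional parts of multiplications by the radices `w n`. -/
noncomputable def radixOrbit (w : ℕ → ℕ) (t : ℝ) : ℕ → ℝ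
  | 0 => t
  | n + 1 => Int.fract (w n * radixOrbit w t n)

/-- The digits of `t` in the mixed radix system `w`. -/
noncomputable def radixDigit (w : ℕ → ℕ) (t : ℝ) (n : ℕ) : ℕ := ⌊w n * radixOrbit w t n⌋₊

theorem radixOrbit_mem (w : ℕ → ℕ) {t : ℝ} (ht : t ∈ Ico (0 : ℝ) 1) (n : ℕ) :
    radixOrbit w t n ∈ Ico (0 : ℝ) 1 := by
  cases n with
  | zero => exact ht
  | succ n => exact ⟨Int.fract_nonneg _, Int.fract_lt_one _⟩

theorem mul_radixOrbit (w : ℕ → ℕ) {t : ℝ} (ht : t ∈ Ico (0 : ℝ) 1) (n : ℕ) :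
    w n * radixOrbit w t n = radixDigit w t n + radixOrbit w t (n + 1) := by
  have h0 : 0 ≤ w n * radixOrbit w t n := mul_nonneg (Nat.cast_nonneg _) (radixOrbit_mem w ht n).1
  rw [radixDigit, radixOrbit, natCast_floor_eq_intCast_floor h0, Int.floor_add_fract]

theorem radixDigit_lt {w : ℕ → ℕ} (hw : ∀ n, 1 ≤ w n) {t : ℝ} (ht : t ∈ Ico (0 : ℝ) 1) (n : ℕ) :
    radixDigit w t n < w n := by
  have h := radixOrbit_mem w ht n
  have hw' : (0 : ℝ) < w n := by exact_mod_cast hw n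
  rw [radixDigit, Nat.floor_lt (mul_nonneg hw'.le h.1)]
  nlinarith [h.2]

theorem sub_mul_prod_radix (w : ℕ → ℕ) {t u : ℝ} (ht : t ∈ Ico (0 : ℝ) 1)
    (hu : u ∈ Ico (0 : ℝ) 1) (n : ℕ) (h : ∀ k < n, radixDigit w t k = radixDigit w u k) :
    (t - u) * ∏ k ∈ Finset.range n, (w k : ℝ) = radixOrbit w t n - radixOrbit w u n := by
  induction n with
  | zero => simp [radixOrbit]
  | succ n ih =>
    rw [Finset.prod_range_succ, ← mul_assoc, ih fun k hk => h k (by omega), sub_mul, mul_comm,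
      mul_radixOrbit w ht, mul_comm (radixOrbit w u n), mul_radixOrbit w hu, h n (by omega)]
    ring

theorem abs_sub_mul_prod_radix_le_one (w : ℕ → ℕ) {t u : ℝ} (ht : t ∈ Ico (0 : ℝ) 1)
    (hu : u ∈ Ico (0 : ℝ) 1) (n : ℕ) (h : ∀ k < n, radixDigit w t k = radixDigit w u k) :
    |t - u| * ∏ k ∈ Finset.range n, (w k : ℝ) ≤ 1 := by
  have h1 := radixOrbit_mem w ht n
  have h2 := radixOrbit_mem w hu n
  rw [← abs_of_nonneg (Finset.prod_nonneg fun k (_ : k ∈ Finset.range n) =>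
    Nat.cast_nonneg (α := ℝ) (w k)), ← abs_mul, sub_mul_prod_radix w ht hu n h, abs_le]
  constructor <;> linarith [h1.1, h1.2, h2.1, h2.2]

/-- The tails differ by at most 1, hence by at most the gap of two distinct integer digits; this is
the factor 2. -/
theorem abs_sub_mul_prod_radix_le (w : ℕ → ℕ) {t u : ℝ} (ht : t ∈ Ico (0 : ℝ) 1)
    (hu : u ∈ Ico (0 : ℝ) 1) (n : ℕ) (h : ∀ k < n, radixDigit w t k = radixDigit w u k)
    (hn : radixDigit w t n ≠ radixDigit w u n) :
    |t - u| * ∏ k ∈ Finset.range (n + 1), (w k : ℝ) ≤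
      2 * |(radixDigit w t n : ℝ) - radixDigit w u n| := by
  have h1 := radixOrbit_mem w ht (n + 1)
  have h2 := radixOrbit_mem w hu (n + 1)
  have h3 : (1 : ℝ) ≤ |(radixDigit w t n : ℝ) - radixDigit w u n| := by
    have : (1 : ℤ) ≤ |(radixDigit w t n : ℤ) - radixDigit w u n| :=
      Int.one_le_abs (sub_ne_zero.2 (by exact_mod_cast hn))
    exact_mod_cast this
  have h4 : (t - u) * ∏ k ∈ Finset.range (n + 1), (w k : ℝ) =
      ((radixDigit w t n : ℝ) - radixDigit w u n) +
        (radixOrbit w t (n + 1) - radixOrbit w u (n + 1)) := by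
    rw [Finset.prod_range_succ, ← mul_assoc, sub_mul_prod_radix w ht hu n h, sub_mul, mul_comm,
      mul_radixOrbit w ht, mul_comm (radixOrbit w u n), mul_radixOrbit w hu]
    ring
  rw [← abs_of_nonneg (Finset.prod_nonneg fun k (_ : k ∈ Finset.range (n + 1)) =>
    Nat.cast_nonneg (α := ℝ) (w k)), ← abs_mul, h4]
  refine (abs_add_le _ _).trans ?_
  have h5 : |radixOrbit w t (n + 1) - radixOrbit w u (n + 1)| ≤ 1 := by
    rw [abs_le]
    constructor <;> linarith [h1.1, h1.2, h2.1, h2.2]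
  linarith

/-! ### Lower bound: a Cantor set with a Hölder coding -/

/-- A map on the unit interval whose inverse is Hölder continuous has an image of large
dimension. -/
theorem le_dimH_image_of_abs_sub_le {g : ℝ → ℝ} {s C : NNReal} (hs : 0 < s)
    (h : ∀ t ∈ Ico (0 : ℝ) 1, ∀ u ∈ Ico (0 : ℝ) 1, |t - u| ≤ C * |g t - g u| ^ (s : ℝ)) :
    (s : ℝ≥0∞) ≤ dimH (g '' Ico (0 : ℝ) 1) := by
  have hinj : InjOn g (Ico (0 : ℝ) 1) := fun t ht u hu htu => by
    have := h t ht u hu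
    rw [htu, sub_self, abs_zero, Real.zero_rpow (by positivity), mul_zero] at this
    exact sub_eq_zero.1 (abs_nonpos_iff.1 this)
  set f := Function.invFunOn g (Ico (0 : ℝ) 1)
  have hf : ∀ t ∈ Ico (0 : ℝ) 1, f (g t) = t := fun t ht => hinj.leftInvOn_invFunOn ht
  have hhol : HolderOnWith C s f (g '' Ico (0 : ℝ) 1) := by
    rintro _ ⟨t, ht, rfl⟩ _ ⟨u, hu, rfl⟩
    rw [hf t ht, hf u hu, edist_dist, edist_dist, Real.dist_eq, Real.dist_eq,
      ENNReal.ofReal_rpow_of_nonneg (abs_nonneg _) s.coe_nonneg, ← ENNReal.ofReal_coe_nnreal (p := C),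
      ← ENNReal.ofReal_mul C.coe_nonneg]
    exact ENNReal.ofReal_le_ofReal (h t ht u hu)
  have himage : f '' (g '' Ico (0 : ℝ) 1) = Ico (0 : ℝ) 1 := by
    rw [image_image]
    exact (image_congr hf).trans (image_id' _)
  have hdim : dimH (Ico (0 : ℝ) 1) = 1 := by
    rw [Real.dimH_of_nonempty_interior]
    · simp
    · rw [interior_Ico]
      exact nonempty_Ioo.2 one_pos
  have := hhol.dimH_image_le hs
  rw [himage, hdim, ENNReal.le_div_iff_mul_le (Or.inl (by simpa using hs.ne')) (Or.inl (by simp)),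
    one_mul] at this
  exact this

/-- The irrationals of the unit interval whose running maxima of partial quotients are asymptotic to
`β * exp (l n)`. -/
def maxDigitSet (l : ℕ → ℝ) (β : ℝ) : Set ℝ :=
  {x | x ∈ unitIrrational ∧ Tendsto (fun n : ℕ =>
    (((Finset.range (n + 1)).sup (cfDigit x) : ℕ) : ℝ) / Real.exp (l n)) atTop (𝓝 β)}

/-- The number of admissible values of the `k`-th digit in the Cantor set below. -/
noncomputable def digitWidth (l : ℕ → ℝ) (k : ℕ) : ℕ := ⌈Real.exp (l k) / (k + 1)⌉₊

/-- The least admissible value of the `k`-th digit in the Cantor set below. -/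
noncomputable def digitBase (l : ℕ → ℝ) (β : ℝ) (k : ℕ) : ℕ := ⌈β * Real.exp (l k)⌉₊ + 2

theorem one_le_digitWidth (l : ℕ → ℝ) (k : ℕ) : 1 ≤ digitWidth l k :=
  Nat.ceil_pos.2 (by positivity)

theorem digitBase_add_digitWidth_le {l : ℕ → ℝ} {β : ℝ} (hβ : 0 < β) (k : ℕ) :
    ((digitBase l β k + digitWidth l k : ℕ) : ℝ) ≤
      β * Real.exp (l k) + 4 + Real.exp (l k) / (k + 1) := by
  have h1 := Nat.ceil_lt_add_one (a := β * Real.exp (l k)) (by positivity)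
  have h2 := Nat.ceil_lt_add_one (a := Real.exp (l k) / (k + 1)) (by positivity)
  rw [digitBase, digitWidth]
  push_cast
  linarith

/-- Digit sequences in the admissible windows are asymptotic to `β * exp (l n)`. -/
theorem tendsto_digit_div_exp {l : ℕ → ℝ} {β : ℝ} (hβ : 0 < β) (hl : Tendsto l atTop atTop)
    {a : ℕ → ℕ} (h1 : ∀ k, digitBase l β k ≤ a k)
    (h2 : ∀ k, a k < digitBase l β k + digitWidth l k) :
    Tendsto (fun n => (a n : ℝ) / Real.exp (l n)) atTop (𝓝 β) := by
  have hlim : Tendsto (fun n : ℕ => β + 4 * Real.exp (-l n) + 1 / ((n : ℝ) + 1)) atTop (𝓝 β) := by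
    have := (tendsto_const_nhds (x := β)).add
      ((Real.tendsto_exp_neg_atTop_nhds_zero.comp hl).const_mul 4)
    simpa using this.add tendsto_one_div_add_atTop_nhds_zero_nat
  refine tendsto_of_tendsto_of_tendsto_of_le_of_le tendsto_const_nhds hlim (fun n => ?_)
    fun n => ?_
  · rw [le_div_iff₀ (Real.exp_pos _)]
    have h3 : (digitBase l β n : ℝ) ≤ a n := by exact_mod_cast h1 n
    refine le_trans ?_ h3
    rw [digitBase]
    push_cast
    linarith [Nat.le_ceil (β * Real.exp (l n))]
  · rw [div_le_iff₀ (Real.exp_pos _)]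
    have h3 : (a n : ℝ) ≤ (digitBase l β n + digitWidth l n : ℕ) := by exact_mod_cast (h2 n).le
    refine (h3.trans (digitBase_add_digitWidth_le hβ n)).trans (le_of_eq ?_)
    rw [Real.exp_neg]
    field_simp

/-- The windows lose the factors k + 1 ≤ exp(n + 1), in total at most exp((n+1)^2). -/
theorem exp_sub_le_prod_digitWidth (l : ℕ → ℝ) (n : ℕ) :
    Real.exp (∑ k ∈ Finset.range n, l k - ((n : ℝ) + 1) ^ 2) ≤
      ∏ k ∈ Finset.range n, (digitWidth l k : ℝ) := by
  have h1 : ∑ k ∈ Finset.range n, l k - ((n : ℝ) + 1) ^ 2 ≤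
      ∑ k ∈ Finset.range n, (l k - ((n : ℝ) + 1)) := by
    rw [Finset.sum_sub_distrib, Finset.sum_const, Finset.card_range, nsmul_eq_mul]
    nlinarith
  refine (Real.exp_le_exp.2 h1).trans ?_
  rw [← exp_sum_range]
  refine Finset.prod_le_prod (fun _ _ => (Real.exp_pos _).le) fun k hk => ?_
  refine le_trans ?_ (Nat.le_ceil _)
  rw [Real.exp_sub]
  have h2 : (k : ℝ) < n := by exact_mod_cast Finset.mem_range.1 hk
  have h3 := Real.add_one_le_exp ((n : ℝ) + 1)
  gcongr
  linarith

/-- The growth condition bounding the local Hölder constants of the inverse of the coding map. -/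
theorem eventually_prod_rpow_le {l : ℕ → ℝ} {s M : ℝ} (hs0 : 0 ≤ s) (hM : 1 ≤ M)
    (hs : ∀ C : ℝ, ∀ᶠ n : ℕ in atTop, s * (2 * ∑ k ∈ Finset.range n, l k + l n) +
      C * ((n : ℝ) + 1) ^ 2 ≤ ∑ k ∈ Finset.range n, l k) :
    ∀ᶠ n : ℕ in atTop, (∏ k ∈ Finset.range (n + 1), (M * Real.exp (l k)) ^ 2) ^ s ≤
      (∏ k ∈ Finset.range n, (digitWidth l k : ℝ)) * (digitWidth l n : ℝ) ^ s := by
  -- `2 * s * log M` pays for M^(2(n+1)s), `1` for the divisors k + 1 in the product of widths, and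
  -- `s` for the one in the last width.
  filter_upwards [hs (2 * s * Real.log M + 1 + s)] with n hn
  have hnum : ∏ k ∈ Finset.range (n + 1), (M * Real.exp (l k)) ^ 2 =
      Real.exp (2 * ((n + 1) * Real.log M + (∑ k ∈ Finset.range n, l k + l n))) := by
    rw [Finset.prod_pow, Finset.prod_mul_distrib, exp_sum_range, Finset.sum_range_succ,
      Finset.prod_const, Finset.card_range, mul_comm 2, Real.exp_mul,
      Real.exp_add (((n : ℝ) + 1) * Real.log M), mul_comm _ (Real.log M), Real.exp_mul,
      Real.exp_log (by linarith)]
    norm_cast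
  have hlast : Real.exp (l n - (n + 1)) ≤ digitWidth l n := by
    refine le_trans ?_ (Nat.le_ceil _)
    rw [Real.exp_sub]
    have h3 := Real.add_one_le_exp ((n : ℝ) + 1)
    gcongr
    linarith
  have hden : Real.exp ((∑ k ∈ Finset.range n, l k - ((n : ℝ) + 1) ^ 2) +
      (l n - (n + 1)) * s) ≤
      (∏ k ∈ Finset.range n, (digitWidth l k : ℝ)) * (digitWidth l n : ℝ) ^ s := by
    rw [Real.exp_add, Real.exp_mul]
    exact mul_le_mul (exp_sub_le_prod_digitWidth l n)
      (Real.rpow_le_rpow (Real.exp_pos _).le hlast hs0)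
      (Real.rpow_nonneg (Real.exp_pos _).le _) (Finset.prod_nonneg fun _ _ => Nat.cast_nonneg _)
  refine le_trans ?_ hden
  rw [hnum, ← Real.exp_mul, Real.exp_le_exp]
  have h2 : (0 : ℝ) ≤ n := Nat.cast_nonneg n
  have h3 : ((n : ℝ) + 1) ≤ (n + 1) ^ 2 := by nlinarith
  have h4 : 0 ≤ s * Real.log M := mul_nonneg hs0 (Real.log_nonneg hM)
  have h5 := mul_le_mul_of_nonneg_left h3 h4
  have h6 := mul_le_mul_of_nonneg_left h3 hs0
  linarith

/-- The Hölder estimate at a pair of points whose digits, in a window of width `w`, differ by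
`Δ`. -/
theorem le_mul_rpow_of_digit_gap {Δ τ δ W w P K s : ℝ} (hΔ0 : 0 < Δ) (hΔw : Δ ≤ w) (hW : 0 < W)
    (hP : 0 ≤ P) (hδ : 0 ≤ δ) (hs0 : 0 ≤ s) (hs1 : s ≤ 1) (h1 : τ * (W * w) ≤ 2 * Δ)
    (h2 : Δ ≤ 2 * (δ * P)) (hK : P ^ s ≤ K * (W * w ^ s)) : τ ≤ 4 * K * δ ^ s := by
  have hw : 0 < w := hΔ0.trans_le hΔw
  -- Split Δ = Δ^(1-s) Δ^s: the window bounds the first factor, the separation of the images bounds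
  -- the second.
  have h3 : Δ ≤ w ^ (1 - s) * (2 * (δ ^ s * P ^ s)) := by
    calc Δ = Δ ^ (1 - s) * Δ ^ s := by
          rw [← Real.rpow_add hΔ0, sub_add_cancel, Real.rpow_one]
      _ ≤ w ^ (1 - s) * (2 * (δ * P)) ^ s :=
          mul_le_mul (Real.rpow_le_rpow hΔ0.le hΔw (by linarith))
            (Real.rpow_le_rpow hΔ0.le h2 hs0) (by positivity) (by positivity)
      _ ≤ _ := by
          rw [Real.mul_rpow two_pos.le (by positivity), Real.mul_rpow hδ hP]
          gcongr
          exact (Real.rpow_le_rpow_of_exponent_le one_le_two hs1).trans_eq (Real.rpow_one _)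
  have h4 : w ^ (1 - s) * w ^ s = w := by
    rw [← Real.rpow_add hw, sub_add_cancel, Real.rpow_one]
  have h5 : τ * (W * w) ≤ 4 * K * δ ^ s * (W * w) := by
    calc _ ≤ 2 * Δ := h1
      _ ≤ 2 * (w ^ (1 - s) * (2 * (δ ^ s * (K * (W * w ^ s))))) := by
          refine mul_le_mul_of_nonneg_left (h3.trans ?_) two_pos.le
          gcongr
      _ = 4 * K * δ ^ s * (W * (w ^ (1 - s) * w ^ s)) := by ring
      _ = _ := by rw [h4]
  exact le_of_mul_le_mul_right h5 (by positivity)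

theorem eq_of_radixDigit_digitWidth_eq {l : ℕ → ℝ}
    (hl : ∀ᶠ n : ℕ in atTop, 2 * ((n : ℝ) + 1) ^ 2 ≤ ∑ k ∈ Finset.range n, l k) {t u : ℝ}
    (ht : t ∈ Ico (0 : ℝ) 1) (hu : u ∈ Ico (0 : ℝ) 1)
    (h : ∀ k, radixDigit (digitWidth l) t k = radixDigit (digitWidth l) u k) : t = u := by
  by_contra hne
  have hpos : 0 < |t - u| := abs_pos.2 (sub_ne_zero.2 hne)
  have hle : ∀ n, ∏ k ∈ Finset.range n, (digitWidth l k : ℝ) ≤ 1 / |t - u| := fun n => by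
    rw [le_div_iff₀' hpos]
    exact abs_sub_mul_prod_radix_le_one _ ht hu n fun k _ => h k
  have hev : ∀ᶠ n : ℕ in atTop, (n : ℝ) ≤ 1 / |t - u| := by
    filter_upwards [hl] with n hn
    refine le_trans ?_ ((exp_sub_le_prod_digitWidth l n).trans (hle n))
    have h3 := Real.add_one_le_exp (∑ k ∈ Finset.range n, l k - ((n : ℝ) + 1) ^ 2)
    nlinarith [Nat.cast_nonneg (α := ℝ) n]
  obtain ⟨n, hn1, hn2⟩ := (hev.and (tendsto_natCast_atTop_atTop.eventually_gt_atTop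
    (1 / |t - u|))).exists
  exact absurd hn1 (not_le.2 hn2)

theorem le_dimH_maxDigitSet {l : ℕ → ℝ} (h0 : ∀ k, 0 ≤ l k) (hmono : Monotone l)
    (hl : Tendsto l atTop atTop)
    (hratio : Tendsto (fun n => Real.exp (l n) / Real.exp (l (n + 1))) atTop (𝓝 0))
    {β : ℝ} (hβ : 0 < β) {s : NNReal} (hs0 : 0 < s) (hs1 : s ≤ 1)
    (hs : ∀ C : ℝ, ∀ᶠ n : ℕ in atTop, s * (2 * ∑ k ∈ Finset.range n, l k + l n) +
      C * ((n : ℝ) + 1) ^ 2 ≤ ∑ k ∈ Finset.range n, l k) :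
    (s : ℝ≥0∞) ≤ dimH (maxDigitSet l β) := by
  have hex : ∀ t : ℝ, ∃ x ∈ unitIrrational,
      ∀ k, cfDigit x k = digitBase l β k + radixDigit (digitWidth l) t k :=
    -- The summand 2 in `digitBase` guarantees digits at least 2.
    fun t => exists_cfDigit_eq fun k => by rw [digitBase]; omega
  choose g hg hgd using hex
  have hlt : ∀ t ∈ Ico (0 : ℝ) 1, ∀ k, radixDigit (digitWidth l) t k < digitWidth l k :=
    fun t ht k => radixDigit_lt (one_le_digitWidth l) ht k
  have hmem : g '' Ico (0 : ℝ) 1 ⊆ maxDigitSet l β := by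
    rintro _ ⟨t, ht, rfl⟩
    refine ⟨hg t, (tendsto_sup_div_iff (fun n => Real.exp_pos _)
      (Real.exp_monotone.comp hmono) hratio _ hβ).2 ?_⟩
    refine tendsto_digit_div_exp hβ hl (fun k => ?_) fun k => ?_
    · rw [hgd]; omega
    · rw [hgd]
      have := hlt t ht k
      omega
  have hB : ∀ t ∈ Ico (0 : ℝ) 1, ∀ k,
      (cfDigit (g t) k : ℝ) + 1 ≤ (β + 5) * Real.exp (l k) := by
    intro t ht k
    have h1 : (cfDigit (g t) k : ℝ) + 1 ≤ (digitBase l β k + digitWidth l k : ℕ) := by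
      have := hlt t ht k
      rw [hgd]
      norm_cast
      omega
    refine (h1.trans (digitBase_add_digitWidth_le hβ k)).trans ?_
    have h2 := Real.one_le_exp (h0 k)
    have h3 : Real.exp (l k) / (k + 1) ≤ Real.exp (l k) :=
      div_le_self (Real.exp_pos _).le (by linarith [Nat.cast_nonneg (α := ℝ) k])
    linarith
  have hwpos : ∀ k, (0 : ℝ) < digitWidth l k := fun k => by exact_mod_cast one_le_digitWidth l k
  have hprod : ∀ n, 0 < ∏ k ∈ Finset.range n, (digitWidth l k : ℝ) :=
    fun n => Finset.prod_pos fun k _ => hwpos k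
  have hden : ∀ n, 0 < (∏ k ∈ Finset.range n, (digitWidth l k : ℝ)) *
      (digitWidth l n : ℝ) ^ (s : ℝ) :=
    fun n => mul_pos (hprod n) (Real.rpow_pos_of_pos (hwpos n) _)
  -- The quotient is eventually at most 1; the finitely many other n only enlarge the Hölder
  -- constant.
  have hbdd : BddAbove (range fun n : ℕ =>
      (∏ k ∈ Finset.range (n + 1), ((β + 5) * Real.exp (l k)) ^ 2) ^ (s : ℝ) /
      ((∏ k ∈ Finset.range n, (digitWidth l k : ℝ)) * (digitWidth l n : ℝ) ^ (s : ℝ))) := by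
    refine IsBoundedUnder.bddAbove_range ⟨1, ?_⟩
    rw [eventually_map]
    filter_upwards [eventually_prod_rpow_le s.coe_nonneg (by linarith : 1 ≤ β + 5) hs] with n hn
    exact (div_le_one (hden n)).2 hn
  obtain ⟨K, hK⟩ := hbdd
  have hK0 : 0 ≤ K := le_trans (by positivity) (hK (mem_range_self 0))
  refine le_trans (le_dimH_image_of_abs_sub_le (C := (4 * K).toNNReal) hs0 ?_) (dimH_mono hmem)
  intro t ht u hu
  rw [Real.coe_toNNReal _ (by linarith)]
  by_cases hall : ∀ k, radixDigit (digitWidth l) t k = radixDigit (digitWidth l) u k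
  · have hev : ∀ᶠ n : ℕ in atTop, 2 * ((n : ℝ) + 1) ^ 2 ≤ ∑ k ∈ Finset.range n, l k := by
      filter_upwards [hs 2] with n hn
      have h1 : 0 ≤ ∑ k ∈ Finset.range n, l k := Finset.sum_nonneg fun k _ => h0 k
      have h2 : 0 ≤ (s : ℝ) * (2 * ∑ k ∈ Finset.range n, l k + l n) :=
        mul_nonneg s.coe_nonneg (by linarith [h0 n])
      linarith
    rw [eq_of_radixDigit_digitWidth_eq hev ht hu hall, sub_self, abs_zero]
    positivity
  · push Not at hall
    classical
    obtain ⟨n, hn, hmin⟩ : ∃ n, radixDigit (digitWidth l) t n ≠ radixDigit (digitWidth l) u n ∧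
        ∀ k < n, radixDigit (digitWidth l) t k = radixDigit (digitWidth l) u k :=
      ⟨Nat.find hall, Nat.find_spec hall, fun k hk => not_not.1 (Nat.find_min hall hk)⟩
    have h1 := abs_sub_mul_prod_radix_le _ ht hu n hmin hn
    have h2 := abs_cfDigit_sub_le (hg t) (hg u) (hB t ht) (hB u hu)
      (fun k => by rw [hgd, digitBase]; omega) (fun k => by rw [hgd, digitBase]; omega) n
      (fun k hk => by rw [hgd, hgd, hmin k hk]) (by rw [hgd, hgd]; omega)
    rw [hgd, hgd] at h2
    push_cast at h2
    rw [add_sub_add_left_eq_sub] at h2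
    have hΔw : |(radixDigit (digitWidth l) t n : ℝ) - radixDigit (digitWidth l) u n| ≤
        digitWidth l n := by
      have h3 : (radixDigit (digitWidth l) t n : ℝ) < digitWidth l n := by
        exact_mod_cast hlt t ht n
      have h4 : (radixDigit (digitWidth l) u n : ℝ) < digitWidth l n := by
        exact_mod_cast hlt u hu n
      have h5 := Nat.cast_nonneg (α := ℝ) (radixDigit (digitWidth l) t n)
      have h6 := Nat.cast_nonneg (α := ℝ) (radixDigit (digitWidth l) u n)
      rw [abs_le]
      constructor <;> linarith
    rw [Finset.prod_range_succ] at h1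
    exact le_mul_rpow_of_digit_gap (abs_pos.2 (sub_ne_zero.2 (by exact_mod_cast hn))) hΔw (hprod n)
      (Finset.prod_nonneg fun k _ => sq_nonneg _) (abs_nonneg _) s.coe_nonneg hs1 h1 h2
      ((div_le_iff₀ (hden n)).1 (hK (mem_range_self n)))

/-! ### Upper bound for the set of running maxima -/

theorem dimH_maxDigitSet_le {l : ℕ → ℝ} (h0 : ∀ k, 0 ≤ l k) (hmono : Monotone l)
    (hpoly : ∀ C : ℝ, ∀ᶠ n : ℕ in atTop, C * ((n : ℝ) + 1) ^ 2 ≤ l n)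
    (hratio : Tendsto (fun n => Real.exp (l n) / Real.exp (l (n + 1))) atTop (𝓝 0))
    {β : ℝ} (hβ : 0 < β) {s : NNReal}
    (hs : ∀ C : ℝ, ∀ᶠ n : ℕ in atTop, ∑ k ∈ Finset.range n, l k + C * ((n : ℝ) + 1) ^ 2 ≤
      s * (2 * ∑ k ∈ Finset.range n, l k + l n)) :
    dimH (maxDigitSet l β) ≤ s := by
  have hsub : maxDigitSet l β ⊆ ⋃ D : ℕ, comparableDigitSet l (D + 1) := by
    rintro x ⟨hx, hlim⟩
    rw [tendsto_sup_div_iff (fun n => Real.exp_pos _) (Real.exp_monotone.comp hmono) hratio _ hβ]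
      at hlim
    obtain ⟨K, hK⟩ := hlim.bddAbove_range
    -- Convergence to β > 0 bounds both a_k / exp(l_k) and its inverse over all k, so a single D
    -- works.
    obtain ⟨K', hK'⟩ := (hlim.inv₀ hβ.ne').bddAbove_range
    obtain ⟨D, hD⟩ := exists_nat_ge (max K K')
    refine mem_iUnion.2 ⟨D, hx, fun k => ?_⟩
    have ha : (0 : ℝ) < cfDigit x k := by exact_mod_cast one_le_cfDigit hx k
    have h1 := hK (mem_range_self k)
    have h2 := hK' (mem_range_self k)
    simp only [inv_div] at h2
    rw [div_le_iff₀ (Real.exp_pos _)] at h1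
    rw [div_le_iff₀ ha] at h2
    push_cast
    refine ⟨h2.trans ?_, h1.trans ?_⟩
    · gcongr
      linarith [le_max_right K K']
    · gcongr
      linarith [le_max_left K K']
  refine (dimH_mono hsub).trans ?_
  rw [dimH_iUnion]
  exact iSup_le fun D => dimH_comparableDigitSet_le h0 hpoly hs (Nat.le_add_left 1 D)

/-! ### Growth of the doubly exponential scale -/

/-- The logarithm of the scale `c ^ (b ^ (n ^ α))` at `n + 1`. -/
noncomputable def logScale (b c α : ℝ) (n : ℕ) : ℝ := Real.log c * b ^ (((n : ℝ) + 1) ^ α)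

theorem exp_logScale {c : ℝ} (hc : 1 < c) (b α : ℝ) (n : ℕ) :
    Real.exp (logScale b c α n) = c ^ (b ^ (((n : ℝ) + 1) ^ α)) := by
  rw [logScale, Real.rpow_def_of_pos (zero_lt_one.trans hc)]

theorem doublyExpSet_eq_maxDigitSet {c : ℝ} (hc : 1 < c) (b α β : ℝ) :
    doublyExpSet b c α β = maxDigitSet (logScale b c α) β := by
  ext x
  rw [doublyExpSet, maxDigitSet, mem_ofPred_eq, mem_ofPred_eq, ← and_assoc]
  refine and_congr_right fun hx => ?_
  -- Digits are indexed from 0 here, so the term at `n + 1` of the original sequence matches index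
  -- n.
  rw [← tendsto_add_atTop_iff_nat 1]
  refine tendsto_congr fun n => ?_
  rw [maxPartialQuotient_succ hx, exp_logScale hc]
  push_cast
  rfl

theorem eventually_mul_sq_le_exp {κ γ : ℝ} (hκ : 0 < κ) (hγ : 0 < γ) (C : ℝ) :
    ∀ᶠ n : ℕ in atTop, C * ((n : ℝ) + 1) ^ 2 ≤ Real.exp (κ * ((n : ℝ) + 1) ^ γ) := by
  have hn : Tendsto (fun n : ℕ => (n : ℝ) + 1) atTop atTop :=
    tendsto_atTop_add_const_right _ _ tendsto_natCast_atTop_atTop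
  have h := ((tendsto_rpow_mul_exp_neg_mul_atTop_nhds_zero (2 / γ) κ hκ).comp
    ((tendsto_rpow_atTop hγ).comp hn)).const_mul C
  rw [mul_zero] at h
  filter_upwards [h.eventually_le_const zero_lt_one] with n hn
  have hpos : (0 : ℝ) ≤ (n : ℝ) + 1 := by positivity
  simp only [Function.comp_apply] at hn
  rw [← Real.rpow_mul hpos, mul_div_cancel₀ _ hγ.ne', neg_mul, Real.exp_neg, ← mul_assoc,
    ← div_eq_mul_inv, div_le_one (Real.exp_pos _)] at hn
  exact_mod_cast hn

section logScale

variable {b c α : ℝ}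

theorem logScale_pos (hb : 1 < b) (hc : 1 < c) (n : ℕ) : 0 < logScale b c α n :=
  mul_pos (Real.log_pos hc) (Real.rpow_pos_of_pos (zero_lt_one.trans hb) _)

theorem logScale_monotone (hb : 1 < b) (hc : 1 < c) (hα : 0 < α) :
    Monotone (logScale b c α) := fun m n hmn => by
  have : (m : ℝ) ≤ n := by exact_mod_cast hmn
  exact mul_le_mul_of_nonneg_left (Real.rpow_le_rpow_of_exponent_le hb.le
    (Real.rpow_le_rpow (by positivity) (by linarith) hα.le)) (Real.log_pos hc).le

theorem eventually_mul_sq_le_logScale (hb : 1 < b) (hc : 1 < c) (hα : 0 < α) (C : ℝ) :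
    ∀ᶠ n : ℕ in atTop, C * ((n : ℝ) + 1) ^ 2 ≤ logScale b c α n := by
  have hlog := Real.log_pos hc
  filter_upwards [eventually_mul_sq_le_exp (Real.log_pos hb) hα (C / Real.log c)] with n hn
  rw [logScale, Real.rpow_def_of_pos (zero_lt_one.trans hb)]
  rw [div_mul_eq_mul_div, div_le_iff₀' hlog] at hn
  exact hn

theorem logScale_tendsto (hb : 1 < b) (hc : 1 < c) (hα : 0 < α) :
    Tendsto (logScale b c α) atTop atTop := by
  refine tendsto_atTop_mono' _ ?_ tendsto_natCast_atTop_atTop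
  filter_upwards [eventually_mul_sq_le_logScale hb hc hα 1] with n hn
  nlinarith [Nat.cast_nonneg (α := ℝ) n]

theorem logScale_succ (hb : 1 < b) (n : ℕ) : logScale b c α (n + 1) =
    logScale b c α n * b ^ (((n : ℝ) + 1 + 1) ^ α - ((n : ℝ) + 1) ^ α) := by
  rw [logScale, logScale, mul_assoc, ← Real.rpow_add (zero_lt_one.trans hb), add_sub_cancel]
  push_cast
  rfl

theorem add_one_rpow_eq {y : ℝ} (hy : 0 < y) : (y + 1) ^ α = y ^ α * (1 + 1 / y) ^ α := by
  rw [← Real.mul_rpow hy.le (by positivity), mul_add, mul_one, mul_one_div_cancel hy.ne']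

/-- Using log(1 + 1/y) ≥ 1/(y+1) and exp u ≥ 1 + u avoids any case distinction between concave and
convex powers. -/
theorem div_add_one_le_rpow_sub (hα : 0 < α) {y : ℝ} (hy : 1 ≤ y) :
    α / (y + 1) ≤ (y + 1) ^ α - y ^ α := by
  have hy0 : 0 < y := by linarith
  have h1 : 1 / (y + 1) ≤ Real.log (1 + 1 / y) := by
    refine le_trans (le_of_eq ?_) (Real.one_sub_inv_le_log_of_pos (by positivity))
    field_simp
    ring
  have h2 : 1 + α / (y + 1) ≤ (1 + 1 / y) ^ α := by
    rw [Real.rpow_def_of_pos (by positivity)]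
    refine le_trans ?_ (Real.add_one_le_exp _)
    rw [add_comm, div_eq_mul_one_div, mul_comm]
    gcongr
  have h3 := Real.one_le_rpow hy hα.le
  have h4 : 0 ≤ α / (y + 1) := by positivity
  rw [add_one_rpow_eq hy0]
  nlinarith

theorem exp_logScale_ratio_tendsto (hb : 1 < b) (hc : 1 < c) (hα : 0 < α) :
    Tendsto (fun n => Real.exp (logScale b c α n) / Real.exp (logScale b c α (n + 1)))
      atTop (𝓝 0) := by
  simp_rw [← Real.exp_sub]
  refine Real.tendsto_exp_atBot.comp (tendsto_atBot_mono' _ ?_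
      (tendsto_neg_atTop_atBot.comp tendsto_natCast_atTop_atTop))
  have hlb := Real.log_pos hb
  filter_upwards [eventually_mul_sq_le_logScale hb hc hα (1 / (Real.log b * α))] with n hn
  have hn0 := Nat.cast_nonneg (α := ℝ) n
  have h1 := div_add_one_le_rpow_sub hα (y := (n : ℝ) + 1) (by linarith)
  set δ := ((n : ℝ) + 1 + 1) ^ α - ((n : ℝ) + 1) ^ α with hδ
  have h2 : 1 + Real.log b * (α / ((n : ℝ) + 1 + 1)) ≤ b ^ δ := by
    rw [Real.rpow_def_of_pos (zero_lt_one.trans hb)]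
    refine le_trans ?_ (Real.add_one_le_exp _)
    rw [add_comm]
    gcongr
  have h3 : (n : ℝ) ≤ logScale b c α n * (Real.log b * (α / ((n : ℝ) + 1 + 1))) := by
    refine le_trans ?_ (mul_le_mul_of_nonneg_right hn (by positivity))
    have : 1 / (Real.log b * α) * ((n : ℝ) + 1) ^ 2 * (Real.log b * (α / ((n : ℝ) + 1 + 1))) =
        ((n : ℝ) + 1) ^ 2 / ((n : ℝ) + 1 + 1) := by field_simp
    rw [this, le_div_iff₀ (by positivity)]
    nlinarith
  have h4 := mul_le_mul_of_nonneg_left h2 (logScale_pos (α := α) hb hc n).le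
  rw [logScale_succ hb, ← hδ]
  simp only [Function.comp_apply]
  linarith

theorem eventually_logScale_succ_le (hb : 1 < b) (hc : 1 < c) (hα : 0 < α) (hα1 : α < 1) {ε : ℝ}
    (hε : 0 < ε) :
    ∀ᶠ n : ℕ in atTop, logScale b c α (n + 1) ≤ (1 + ε) * logScale b c α n := by
  have hlim : Tendsto (fun n : ℕ => ((n : ℝ) + 1 + 1) ^ α - ((n : ℝ) + 1) ^ α) atTop (𝓝 0) := by
    have hn : Tendsto (fun n : ℕ => (n : ℝ) + 1) atTop atTop :=
      tendsto_atTop_add_const_right _ _ tendsto_natCast_atTop_atTop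
    have h := ((tendsto_rpow_neg_atTop (sub_pos.2 hα1)).comp hn).const_mul α
    rw [mul_zero] at h
    refine squeeze_zero (fun n => ?_) (fun n => ?_) h
    · exact sub_nonneg.2 (Real.rpow_le_rpow (by positivity) (by linarith) hα.le)
    · have hy : (0 : ℝ) < (n : ℝ) + 1 := by positivity
      have h1 := rpow_one_add_le_one_add_mul_self (s := 1 / ((n : ℝ) + 1))
        (by have : 0 ≤ 1 / ((n : ℝ) + 1) := by positivity
            linarith) hα.le hα1.le
      have h2 := mul_le_mul_of_nonneg_left h1 (Real.rpow_nonneg hy.le α)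
      rw [← add_one_rpow_eq hy] at h2
      have h3 : ((n : ℝ) + 1) ^ (-(1 - α)) = ((n : ℝ) + 1) ^ α * (1 / ((n : ℝ) + 1)) := by
        rw [neg_sub, Real.rpow_sub_one hy.ne', mul_one_div]
      simp only [Function.comp_apply]
      rw [h3]
      linarith
  have hpow : Tendsto (fun n : ℕ => b ^ (((n : ℝ) + 1 + 1) ^ α - ((n : ℝ) + 1) ^ α)) atTop
      (𝓝 1) := by
    have := (Real.continuousAt_const_rpow (zero_lt_one.trans hb).ne').tendsto.comp hlim
    rwa [Real.rpow_zero] at this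
  filter_upwards [hpow.eventually_le_const (by linarith : (1 : ℝ) < 1 + ε)] with n hn
  rw [logScale_succ hb, mul_comm]
  exact mul_le_mul_of_nonneg_right hn (logScale_pos hb hc n).le

/-- Summing increments of at most (ε/2) l_k bounds l_n by l_N + (ε/2) S_n; since l_n tends to
infinity, l_N is eventually at most l_n / 2. -/
theorem eventually_logScale_le_mul_sum (hb : 1 < b) (hc : 1 < c) (hα : 0 < α) (hα1 : α < 1)
    {ε : ℝ} (hε : 0 < ε) :
    ∀ᶠ n : ℕ in atTop, logScale b c α n ≤ ε * ∑ k ∈ Finset.range n, logScale b c α k := by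
  obtain ⟨N, hN⟩ := eventually_atTop.1 (eventually_logScale_succ_le hb hc hα hα1 (half_pos hε))
  have h : ∀ n ≥ N, logScale b c α n ≤ logScale b c α N +
      ε / 2 * ∑ k ∈ Finset.range n, logScale b c α k := by
    intro n hn
    induction n, hn using Nat.le_induction with
    | base =>
      have : 0 ≤ ∑ k ∈ Finset.range N, logScale b c α k :=
        Finset.sum_nonneg fun k _ => (logScale_pos hb hc k).le
      nlinarith
    | succ n hn ih =>
      rw [Finset.sum_range_succ]
      linarith [hN n hn]
  filter_upwards [eventually_ge_atTop N,
    (logScale_tendsto hb hc hα).eventually_ge_atTop (2 * logScale b c α N)] with n hn1 hn2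
  linarith [h n hn1]

/-! ### The three regimes of α -/

theorem dimH_doublyExpSet_of_lt_one (hb : 1 < b) (hc : 1 < c) {β : ℝ} (hβ : 0 < β) (hα : 0 < α)
    (hα1 : α < 1) : dimH (doublyExpSet b c α β) = 1 / 2 := by
  have hpoly := eventually_mul_sq_le_logScale hb hc hα
  rw [doublyExpSet_eq_maxDigitSet hc]
  refine le_antisymm ?_ (ENNReal.le_of_forall_nnreal_lt fun s hs => ?_)
  · have h := dimH_maxDigitSet_le (s := 1 / 2) (fun k => (logScale_pos hb hc k).le)
      (logScale_monotone hb hc hα) hpoly (exp_logScale_ratio_tendsto hb hc hα) hβ fun C => by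
        filter_upwards [hpoly (2 * C)] with n hn
        push_cast
        linarith
    simpa using h
  · rcases eq_or_ne s 0 with rfl | hs0
    · simp
    have hs0 : 0 < s := pos_iff_ne_zero.2 hs0
    have hs2 : (s : ℝ) < 1 / 2 := by
      have : (s : ℝ≥0∞) < ((1 / 2 : NNReal) : ℝ≥0∞) := by simpa using hs
      exact_mod_cast this
    have hs0' : (0 : ℝ) < s := hs0
    refine le_dimH_maxDigitSet (fun k => (logScale_pos hb hc k).le)
      (logScale_monotone hb hc hα) (logScale_tendsto hb hc hα)
      (exp_logScale_ratio_tendsto hb hc hα) hβ hs0 ?_ fun C => ?_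
    · have : (s : ℝ) ≤ 1 := by linarith
      exact_mod_cast this
    -- With the error at most l_n, the criterion reduces to (1 + s) l_n ≤ (1 - 2s) S_n.
    · filter_upwards [hpoly C, eventually_logScale_le_mul_sum hb hc hα hα1
        (div_pos (by linarith : 0 < 1 - 2 * (s : ℝ)) (by linarith : 0 < 1 + (s : ℝ)))] with n h1 h2
      rw [div_mul_eq_mul_div, le_div_iff₀ (by linarith)] at h2
      linarith

theorem sum_logScale_one (hb : 1 < b) (n : ℕ) :
    (b - 1) * ∑ k ∈ Finset.range n, logScale b c 1 k = logScale b c 1 n - logScale b c 1 0 := by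
  rw [← Finset.sum_range_sub, Finset.mul_sum]
  refine Finset.sum_congr rfl fun k _ => ?_
  rw [logScale_succ hb, Real.rpow_one, Real.rpow_one, add_sub_cancel_left, Real.rpow_one]
  ring

theorem dimH_doublyExpSet_one (hb : 1 < b) (hc : 1 < c) {β : ℝ} (hβ : 0 < β) :
    dimH (doublyExpSet b c 1 β) = ENNReal.ofReal (1 / (b + 1)) := by
  have hpoly := eventually_mul_sq_le_logScale (α := 1) hb hc one_pos
  have hpos := logScale_pos (α := 1) hb hc
  have hb1 : 0 < b - 1 := by linarith
  rw [doublyExpSet_eq_maxDigitSet hc]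
  refine le_antisymm ?_ (ENNReal.le_of_forall_nnreal_lt fun s hs => ?_)
  · by_contra! hlt
    obtain ⟨s, hs1, hs2⟩ := ENNReal.lt_iff_exists_nnreal_btwn.1 hlt
    have hs : 1 < s * (b + 1) := by
      rw [← ENNReal.ofReal_coe_nnreal, ENNReal.ofReal_lt_ofReal_iff_of_nonneg (by positivity),
        div_lt_iff₀ (by linarith)] at hs1
      exact hs1
    have hs0 : (0 : ℝ) < s := by
      by_contra! h
      nlinarith
    refine absurd (dimH_maxDigitSet_le (s := s) (fun k => (hpos k).le)
      (logScale_monotone hb hc one_pos) hpoly (exp_logScale_ratio_tendsto hb hc one_pos) hβ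
      fun C => ?_) (not_le.2 hs2)
    -- If s ≥ 1/2, then s l_n alone absorbs the error. Otherwise (b-1) S_n = l_n - l_0 leaves the
    -- surplus (s(b+1) - 1) l_n.
    filter_upwards [hpoly (C / s), hpoly (C * (b - 1) / (s * (b + 1) - 1))] with n h1 h2
    rw [div_mul_eq_mul_div, div_le_iff₀ hs0] at h1
    rw [div_mul_eq_mul_div, div_le_iff₀ (by linarith)] at h2
    have h3 : 0 ≤ ∑ k ∈ Finset.range n, logScale b c 1 k :=
      Finset.sum_nonneg fun k _ => (hpos k).le
    rcases le_total (1 / 2) (s : ℝ) with h | h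
    · nlinarith
    · have h4 := sum_logScale_one (c := c) hb n
      have h5 := mul_nonneg (by linarith : 0 ≤ 1 - 2 * (s : ℝ)) (hpos 0).le
      refine le_of_mul_le_mul_left ?_ hb1
      linear_combination h2 + h5 + (1 - 2 * (s : ℝ)) * h4
  · rcases eq_or_ne s 0 with rfl | hs0
    · simp
    have hs0 : 0 < s := pos_iff_ne_zero.2 hs0
    have hs0' : (0 : ℝ) < s := hs0
    have hs : s * (b + 1) < 1 := by
      rw [← ENNReal.ofReal_coe_nnreal, ENNReal.ofReal_lt_ofReal_iff_of_nonneg s.coe_nonneg,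
        lt_div_iff₀ (by linarith)] at hs
      exact hs
    refine le_dimH_maxDigitSet (fun k => (hpos k).le)
      (logScale_monotone hb hc one_pos) (logScale_tendsto hb hc one_pos)
      (exp_logScale_ratio_tendsto hb hc one_pos) hβ hs0 ?_ fun C => ?_
    · have : (s : ℝ) ≤ 1 := by nlinarith
      exact_mod_cast this
    -- After multiplication by b - 1 the surplus is (1 - s(b+1)) l_n; it must cover the error and
    -- the boundary term (1 - 2s) l_0.
    · filter_upwards [hpoly ((C * (b - 1) + logScale b c 1 0) / (1 - s * (b + 1)))] with n h2
      rw [div_mul_eq_mul_div, div_le_iff₀ (by linarith)] at h2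
      have h4 := sum_logScale_one (c := c) hb n
      have h5 := mul_nonneg hs0'.le (hpos 0).le
      have h6 : logScale b c 1 0 ≤ logScale b c 1 0 * ((n : ℝ) + 1) ^ 2 :=
        le_mul_of_one_le_right (hpos 0).le (by nlinarith [Nat.cast_nonneg (α := ℝ) n])
      refine le_of_mul_le_mul_left ?_ hb1
      linear_combination h2 + 2 * h5 + h6 - (1 - 2 * (s : ℝ)) * h4

theorem dimH_doublyExpSet_of_one_lt (hb : 1 < b) (hc : 1 < c) {β : ℝ} (hβ : 0 < β) (hα : 1 < α) :
    dimH (doublyExpSet b c α β) = 0 := by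
  have hα0 : 0 < α := by linarith
  have hpoly := eventually_mul_sq_le_logScale hb hc hα0
  have hpos := logScale_pos (α := α) hb hc
  have hmono := logScale_monotone (α := α) hb hc hα0
  rw [doublyExpSet_eq_maxDigitSet hc, ← nonpos_iff_eq_zero]
  by_contra! hlt
  obtain ⟨s, hs1, hs2⟩ := ENNReal.lt_iff_exists_nnreal_btwn.1 hlt
  have hs0 : (0 : ℝ) < s := by exact_mod_cast hs1
  refine absurd (dimH_maxDigitSet_le (s := s) (fun k => (hpos k).le)
      hmono hpoly (exp_logScale_ratio_tendsto hb hc hα0) hβ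
      fun C => ?_) (not_le.2 hs2)
  have hlog := Real.log_pos hb
  have hev : ∀ᶠ n : ℕ in atTop, ∑ k ∈ Finset.range (n + 1), logScale b c α k ≤
      s / 2 * logScale b c α (n + 1) := by
    -- By Bernoulli the exponent increment is at least α(n+1)^(α-1), so l_(n+1)/l_n eventually
    -- exceeds (2/s)(n+1), while the sum is at most (n+1) l_n.
    filter_upwards [eventually_mul_sq_le_exp (mul_pos hlog hα0) (sub_pos.2 hα) (2 / s)] with n hn
    have hy : (0 : ℝ) < (n : ℝ) + 1 := by positivity
    have hn0 := Nat.cast_nonneg (α := ℝ) n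
    have h1 := one_add_mul_self_le_rpow_one_add (s := 1 / ((n : ℝ) + 1))
      (by have : 0 ≤ 1 / ((n : ℝ) + 1) := by positivity
          linarith) hα.le
    have h2 := mul_le_mul_of_nonneg_left h1 (Real.rpow_nonneg hy.le α)
    rw [← add_one_rpow_eq hy] at h2
    have h3 : ((n : ℝ) + 1) ^ (α - 1) = ((n : ℝ) + 1) ^ α * (1 / ((n : ℝ) + 1)) := by
      rw [Real.rpow_sub_one hy.ne', mul_one_div]
    have h4 : Real.exp (Real.log b * α * ((n : ℝ) + 1) ^ (α - 1)) ≤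
        b ^ (((n : ℝ) + 1 + 1) ^ α - ((n : ℝ) + 1) ^ α) := by
      rw [Real.rpow_def_of_pos (zero_lt_one.trans hb), mul_assoc]
      gcongr
      rw [h3]
      linarith
    have h5 : ∑ k ∈ Finset.range (n + 1), logScale b c α k ≤ ((n : ℝ) + 1) * logScale b c α n := by
      refine (Finset.sum_le_card_nsmul _ _ (logScale b c α n) fun k hk =>
        hmono (Nat.lt_succ_iff.1 (Finset.mem_range.1 hk))).trans (le_of_eq ?_)
      rw [Finset.card_range, nsmul_eq_mul]
      push_cast
      rfl
    have h6 : (n : ℝ) + 1 ≤ s / 2 * b ^ (((n : ℝ) + 1 + 1) ^ α - ((n : ℝ) + 1) ^ α) := by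
      have := hn.trans h4
      rw [div_mul_eq_mul_div, div_le_iff₀ hs0] at this
      nlinarith
    have h7 := mul_le_mul_of_nonneg_left h6 (hpos n).le
    rw [logScale_succ hb]
    linarith
  have hev' : ∀ᶠ n : ℕ in atTop, ∑ k ∈ Finset.range n, logScale b c α k ≤
      s / 2 * logScale b c α n := by
    rw [eventually_atTop] at hev ⊢
    obtain ⟨N, hN⟩ := hev
    refine ⟨N + 1, fun n hn => ?_⟩
    obtain ⟨m, rfl⟩ : ∃ m, n = m + 1 := ⟨n - 1, by omega⟩
    exact hN m (by omega)
  -- Half of s l_n pays for the sum, the other half for the error.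
  filter_upwards [hev', hpoly (2 * C / s)] with n h1 h2
  rw [div_mul_eq_mul_div, div_le_iff₀ hs0] at h2
  have h3 : 0 ≤ (s : ℝ) * ∑ k ∈ Finset.range n, logScale b c α k :=
    mul_nonneg hs0.le (Finset.sum_nonneg fun k _ => (hpos k).le)
  linarith

end logScale

theorem theorem1p3 (b c : ℝ) (hb : 1 < b) (hc : 1 < c) (β : ℝ) (hβ : 0 < β) :
    (∀ α : ℝ, 0 < α → α < 1 → dimH (doublyExpSet b c α β) = 1 / 2) ∧
    (dimH (doublyExpSet b c 1 β) = ENNReal.ofReal (1 / (b + 1))) ∧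
    (∀ α : ℝ, 1 < α → dimH (doublyExpSet b c α β) = 0) :=
  ⟨fun _ hα hα1 => dimH_doublyExpSet_of_lt_one hb hc hβ hα hα1, dimH_doublyExpSet_one hb hc hβ,
    fun _ hα => dimH_doublyExpSet_of_one_lt hb hc hβ hα⟩
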